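/- Let $N\ge 1$, $\mathcal Y=[K]$, $\widehat{\mathcal Y}=[N]$, and let $\ell:[N]\times[K]\to\mathbb R$ be a target loss with a $(\rho,\ell^\rho)$-decomposition, i.e. $\ell(t,y)=\langle\rho(y),\ell^\rho(t)\rangle+c(y)$ for some $\rho:[K]\to\mathbb R^\varrho$, $\ell^\rho:[N]\to\mathbb R^\varrho$ and $c:[K]\to\mathbb R$. Let $\Omega:\mathbb R^\varrho\to\mathbb R\cup\{+\infty\}$ be proper, convex and lower semicontinuous with $\mathrm{conv}(\rho([K]))\subseteq\mathrm{dom}(\Omega)$ and $\mathrm{dom}(\Omega^*)=\mathbb R^\varrho$, where $\Omega^*(\theta)=\sup_{p\in\mathrm{dom}(\Omega)}\langle\theta,p\rangle-\Omega(p)$, and suppose that $\Omega$ is strongly convex on $\mathrm{dom}(\Omega)$. Let $\Delta^N$ be the probability simplex, $\mathcal L^\rho\in\mathbb R^{\varrho\times N}$ the matrix with columns $\ell^\rho(t)$, $T(p)=-\min_{t\in[N]}\langle p,\ell^\rho(t)\rangle$, $\Omega_T=\Omega+T$, and $$L_{\Omega_T}(\theta,y)=\min_{\pi\in\Delta^N}\Omega^*(\theta+\mathcal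 L^\rho\pi)+\Omega_T(\rho(y))-\langle\theta,\rho(y)\rangle$$ the convolutional Fenchel–Young loss. Then: (1) For every $y\in[K]$, the function $L_{\Omega_T}(\cdot,y)$ is finite, convex, differentiable and smooth (its gradient is Lipschitz continuous) on $\mathbb R^\varrho$. (2) Call $\varphi:\mathbb R^\varrho\to[N]$ a $\pi$-argmax link if there is $\pi:\mathbb R^\varrho\to\Delta^N$ with $\pi(\theta)\in\mathrm{argmin}_{\pi'\in\Delta^N}\Omega^*(\theta+\mathcal L^\rho\pi')$ and $\varphi(\theta)\in\mathrm{argmax}_{t\in[N]}\pi_t(\theta)$ for all $\theta$. Such links exist, and every one of them satisfies $$\mathtt{Regret}_\ell(\varphi(\theta),\eta)\le N\cdot\mathtt{Regret}_{L_{\Omega_T}}(\theta,\eta)\qquad\text{for all }\theta\in\mathbb R^\varrho,\ \eta\in\Delta^K,$$ where $\mathtt{Regret}_\ell(t,\eta)=\sum_y\eta_y\ell(t,y)-\min_{t'\in[N]}\sum_y\eta_y\ell(t',y)$ and $\mathtt{Regret}_{L}(\theta,\eta)=\sum_y\eta_yL(\theta,y)-\inf_{\theta'\in\mathbb R^\varrho}\sum_y\eta_yL(\theta',y)$.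 -/

import Mathlib

noncomputable section

namespace ConvFY

/-- The score space `ℝ^d` with its Euclidean norm and inner product. -/
abbrev Vec (d : ℕ) : Type := EuclideanSpace ℝ (Fin d)

/-! ### Discrete target losses `ℓ : [N] × [K] → ℝ` -/

/-- The risk of the prediction `t` under the class distribution `η`. -/
def targetRisk {N K : ℕ} (ℓ : Fin N → Fin K → ℝ) (t : Fin N) (η : Fin K → ℝ) : ℝ :=
  ∑ y, η y * ℓ t y

/-- The Bayes risk: the smallest risk over the (finitely many) predictions. -/
def targetBayesRisk {N K : ℕ} (ℓ : Fin N → Fin K → ℝ) (η : Fin K → ℝ) : ℝ :=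
  ⨅ t : Fin N, targetRisk ℓ t η

/-- The target regret. -/
def targetRegret {N K : ℕ} (ℓ : Fin N → Fin K → ℝ) (t : Fin N) (η : Fin K → ℝ) : ℝ :=
  targetRisk ℓ t η - targetBayesRisk ℓ η

/-- The `(ρ, ℓ^ρ)`-decomposition of a target loss, with remainder `c`:
`ℓ(t, y) = ⟨ρ(y), ℓ^ρ(t)⟩ + c(y)`. -/
def IsDecomposition {N K d : ℕ} (ℓ : Fin N → Fin K → ℝ) (ρ : Fin K → Vec d)
    (ℓρ : Fin N → Vec d) (c : Fin K → ℝ) : Prop :=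
  ∀ t y, ℓ t y = inner ℝ (ρ y) (ℓρ t) + c y

/-! ### Surrogate losses `L : ℝ^d × [K] → ℝ ∪ {∞}` -/

/-- The surrogate risk of the score `θ` under the class distribution `η`. -/
def surrogateRisk {K d : ℕ} (L : Vec d → Fin K → EReal) (θ : Vec d) (η : Fin K → ℝ) : EReal :=
  ∑ y, (η y : EReal) * L θ y

/-- The surrogate Bayes risk, an infimum in the extended reals over all scores. -/
def surrogateBayesRisk {K d : ℕ} (L : Vec d → Fin K → EReal) (η : Fin K → ℝ) : EReal :=
  ⨅ θ : Vec d, surrogateRisk L θ η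

/-- The surrogate regret. -/
def surrogateRegret {K d : ℕ} (L : Vec d → Fin K → EReal) (θ : Vec d) (η : Fin K → ℝ) : EReal :=
  surrogateRisk L θ η - surrogateBayesRisk L η

/-! ### Extended-real-valued convex functions -/

/-- The effective domain `{p | Ω p < ∞}`. -/
def effDom {d : ℕ} (Ω : Vec d → EReal) : Set (Vec d) := {p | Ω p < ⊤}

/-- The Fenchel conjugate `Ω^*(θ) = sup_{p ∈ dom Ω} ⟨θ, p⟩ - Ω p`. -/
def conj {d : ℕ} (Ω : Vec d → EReal) (θ : Vec d) : EReal :=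
  ⨆ p ∈ effDom Ω, (((inner ℝ θ p : ℝ) : EReal) - Ω p)

/-- The standing requirement on a base negentropy `Ω : ℝ^d → ℝ ∪ {∞}`: it is proper, convex and
lower semicontinuous, its domain contains `conv (ρ(𝒴))`, and its conjugate is finite on `ℝ^d`. -/
structure IsAdmissible {K d : ℕ} (ρ : Fin K → Vec d) (Ω : Vec d → EReal) : Prop where
  ne_bot : ∀ p, Ω p ≠ ⊥
  dom_nonempty : (effDom Ω).Nonempty
  convex : ConvexOn ℝ (effDom Ω) (fun p => (Ω p).toReal)
  lsc : LowerSemicontinuous Ω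
  hull_subset : convexHull ℝ (Set.range ρ) ⊆ effDom Ω
  dom_conj : effDom (conj Ω) = Set.univ

/-- `Ω` is strongly convex on its effective domain (with some modulus `m > 0`). -/
def IsStronglyConvexOnDom {d : ℕ} (Ω : Vec d → EReal) : Prop :=
  ∃ m : ℝ, 0 < m ∧ StrongConvexOn (effDom Ω) m (fun p => (Ω p).toReal)

/-! ### The convolutional Fenchel–Young loss and its link -/

/-- `T(p) = - min_t ⟨p, ℓ^ρ(t)⟩`. -/
def polyT {N d : ℕ} (ℓρ : Fin N → Vec d) (p : Vec d) : ℝ :=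
  -⨅ t : Fin N, inner ℝ p (ℓρ t)

/-- The convolutional negentropy `Ω_T = Ω + T`. -/
def convNegentropy {N d : ℕ} (Ω : Vec d → EReal) (ℓρ : Fin N → Vec d) (p : Vec d) : EReal :=
  Ω p + (polyT ℓρ p : EReal)

/-- The product of the `d × N` matrix with columns `ℓ^ρ(t)` and the vector `π`. -/
def lossMatrixMul {N d : ℕ} (ℓρ : Fin N → Vec d) (π : Fin N → ℝ) : Vec d :=
  ∑ t, π t • ℓρ t

/-- The convolutional Fenchel–Young loss
`min_{π ∈ Δ^N} Ω^*(θ + ℒ^ρ π) + Ω_T(ρ(y)) - ⟨θ, ρ(y)⟩`. -/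
def convFYLoss {N K d : ℕ} (Ω : Vec d → EReal) (ρ : Fin K → Vec d) (ℓρ : Fin N → Vec d)
    (θ : Vec d) (y : Fin K) : EReal :=
  (⨅ π ∈ stdSimplex ℝ (Fin N), conj Ω (θ + lossMatrixMul ℓρ π))
    + convNegentropy Ω ℓρ (ρ y) - ((inner ℝ θ (ρ y) : ℝ) : EReal)

/-- `Π(θ) = argmin_{π ∈ Δ^N} Ω^*(θ + ℒ^ρ π)`. -/
def minimizers {N d : ℕ} (Ω : Vec d → EReal) (ℓρ : Fin N → Vec d) (θ : Vec d) :
    Set (Fin N → ℝ) :=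
  {π | π ∈ stdSimplex ℝ (Fin N) ∧
    ∀ π' ∈ stdSimplex ℝ (Fin N),
      conj Ω (θ + lossMatrixMul ℓρ π) ≤ conj Ω (θ + lossMatrixMul ℓρ π')}

/-- `φ` is a `π`-argmax link: for some selector `π(·)` of `Π(·)`, `φ(θ)` maximizes
`t ↦ π_t(θ)`, ties being broken arbitrarily. -/
def IsArgmaxLink {N d : ℕ} (Ω : Vec d → EReal) (ℓρ : Fin N → Vec d) (φ : Vec d → Fin N) : Prop :=
  ∃ π : Vec d → Fin N → ℝ, (∀ θ, π θ ∈ minimizers Ω ℓρ θ) ∧ ∀ θ t, π θ t ≤ π θ (φ θ)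

end ConvFY

end

/-! Write V(θ) for the minimum of Ω^*(θ + ℒ^ρ π) over the simplex. Up to a constant and a linear
term, the loss is V.

Smoothness: m-strong convexity of Ω gives Ω^* a quadratic upper model with constant 1/m at every
point. Freezing the optimal π at θ passes this model on to V, and V is convex as a partial minimum
of a jointly convex function. Convexity together with uniform quadratic upper models forces
differentiability and a Lipschitz gradient.

Regret: for t Bayes optimal, compare θ with θ' = θ + ℒ^ρ π(θ) - ℓ^ρ(t). The vertex t is feasible at
θ', so V(θ') ≤ V(θ), and the surrogate risk drops by at least ⟨θ' - θ, E_η ρ⟩. By the decomposition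
this is the target regret averaged under π(θ). The argmax has weight at least 1/N, whence the factor
N. -/

noncomputable section

namespace ConvFY

open Filter Topology

/-! ### Convex functions with quadratic upper models -/

section Smooth

variable {E : Type*} [NormedAddCommGroup E] [InnerProductSpace ℝ E]

/-- A nonnegative perturbation argument: if `a ≤ t * b` for all small `t > 0`, then `a ≤ 0`. -/
theorem nonpos_of_forall_le_mul {a b : ℝ} (h : ∀ t : ℝ, 0 < t → a ≤ t * b) : a ≤ 0 := by
  have h1 : Tendsto (fun t : ℝ => t * b) (𝓝[>] 0) (𝓝 0) := by
    have : Tendsto (fun t : ℝ => t * b) (𝓝 0) (𝓝 (0 * b)) := tendsto_id.mul_const b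
    rw [zero_mul] at this
    exact this.mono_left nhdsWithin_le_nhds
  exact ge_of_tendsto h1 (eventually_nhdsWithin_of_forall fun t ht => h t ht)

/-- A convex function with a quadratic upper model at every point lies above the affine part of
each model. -/
theorem _root_.ConvexOn.add_inner_le_of_quadratic_bound {f : E → ℝ} (hf : ConvexOn ℝ Set.univ f)
    {x p : E} {C : ℝ} (hp : ∀ y, f y ≤ f x + inner ℝ p (y - x) + C * ‖y - x‖ ^ 2) (y : E) :
    f x + inner ℝ p (y - x) ≤ f y := by
  rw [← sub_nonpos]
  refine nonpos_of_forall_le_mul (b := C * ‖y - x‖ ^ 2) fun t ht => ?_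
  -- Reflect y through x: x is a convex combination of y and this point, where the model bounds f
  -- from above. The error is of order t².
  have h1 := hp (x - t • (y - x))
  have e1 : x - t • (y - x) - x = -(t • (y - x)) := by abel
  rw [e1, inner_neg_right, inner_smul_right, norm_neg, norm_smul, Real.norm_of_nonneg ht.le] at h1
  have h2 := hf.2 (Set.mem_univ y) (Set.mem_univ (x - t • (y - x)))
    (by positivity : 0 ≤ t / (1 + t)) (by positivity : 0 ≤ 1 / (1 + t)) (by field_simp; ring)
  have e2 : (t / (1 + t)) • y + (1 / (1 + t)) • (x - t • (y - x)) = x := by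
    have h3 : x - t • (y - x) = (1 + t) • x - t • y := by module
    rw [h3, smul_sub, smul_smul, smul_smul, one_div_mul_cancel (by positivity),
      one_smul, one_div_mul_eq_div]
    abel
  rw [e2, smul_eq_mul, smul_eq_mul] at h2
  have h4 : (1 + t) * f x ≤ t * f y + f (x - t • (y - x)) := by
    have := mul_le_mul_of_nonneg_left h2 (by positivity : (0 : ℝ) ≤ 1 + t)
    refine this.trans_eq ?_
    field_simp
  have h5 : t * (f x + inner ℝ p (y - x) - f y) ≤ t * (t * (C * ‖y - x‖ ^ 2)) := by
    nlinarith
  exact le_of_mul_le_mul_left h5 ht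

/-- f is squeezed between the affine part and the model, so the linearization error is O(‖y - x‖²).
-/
theorem _root_.ConvexOn.hasGradientAt_of_quadratic_bound [CompleteSpace E] {f : E → ℝ}
    (hf : ConvexOn ℝ Set.univ f) {x p : E} {C : ℝ}
    (hp : ∀ y, f y ≤ f x + inner ℝ p (y - x) + C * ‖y - x‖ ^ 2) : HasGradientAt f p x := by
  rw [hasGradientAt_iff_isLittleO]
  have h1 : (fun y => f y - f x - inner ℝ p (y - x)) =O[𝓝 x] fun y => ‖y - x‖ ^ 2 := by
    refine Asymptotics.IsBigO.of_bound C (Eventually.of_forall fun y => ?_)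
    have h2 := hf.add_inner_le_of_quadratic_bound hp y
    rw [Real.norm_of_nonneg (by linarith), Real.norm_of_nonneg (by positivity)]
    linarith [hp y]
  refine h1.trans_isLittleO ?_
  exact Asymptotics.isLittleO_pow_sub_sub x (by norm_num)

theorem _root_.ConvexOn.lipschitzWith_of_quadratic_bound {f : E → ℝ}
    (hf : ConvexOn ℝ Set.univ f) {p : E → E} {C : NNReal} (hC : 0 < C)
    (hp : ∀ x y, f y ≤ f x + inner ℝ (p x) (y - x) + C * ‖y - x‖ ^ 2) :
    LipschitzWith (4 * C) p := by
  refine LipschitzWith.of_dist_le_mul fun x y => ?_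
  rw [dist_eq_norm, dist_eq_norm]
  have hC' : (0 : ℝ) < C := hC
  set D := p x - p y with hD
  -- At y + s • D the lower bound from x meets the upper model from y; this s maximizes s - C s².
  set s : ℝ := 1 / (2 * C) with hs
  have h1 := hf.add_inner_le_of_quadratic_bound (hp x) (y + s • D)
  have h2 := hp y (y + s • D)
  have h3 := hf.add_inner_le_of_quadratic_bound (hp y) x
  have e1 : y + s • D - x = s • D - (x - y) := by abel
  have e2 : y + s • D - y = s • D := by abel
  have e3 : inner ℝ D D = ‖D‖ ^ 2 := real_inner_self_eq_norm_sq D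
  rw [e1, inner_sub_right, inner_smul_right] at h1
  rw [e2, inner_smul_right, norm_smul, Real.norm_of_nonneg (by positivity)] at h2
  have h4 : inner ℝ D D = inner ℝ (p x) D - inner ℝ (p y) D := by
    conv_lhs => rw [hD, inner_sub_left]
  have h5 : inner ℝ D (x - y) = inner ℝ (p x) (x - y) - inner ℝ (p y) (x - y) :=
    inner_sub_left _ _ _
  have h6 : inner ℝ D (x - y) ≤ ‖D‖ * ‖x - y‖ := real_inner_le_norm _ _
  have h7 : s * ‖D‖ ^ 2 ≤ ‖D‖ * ‖x - y‖ + C * (s * ‖D‖) ^ 2 := by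
    rw [← e3, h4, mul_sub]; linarith
  have h8 : ‖D‖ * ‖D‖ ≤ ‖D‖ * (4 * C * ‖x - y‖) := by
    have e4 : (C : ℝ) * (s * ‖D‖) ^ 2 = ‖D‖ ^ 2 / (4 * C) := by rw [hs]; field_simp; ring
    have e5 : s * ‖D‖ ^ 2 = 2 * (‖D‖ ^ 2 / (4 * C)) := by rw [hs]; field_simp; ring
    rw [e4, e5] at h7
    have h9 : ‖D‖ ^ 2 / (4 * C) ≤ ‖D‖ * ‖x - y‖ := by linarith
    rw [div_le_iff₀ (by positivity)] at h9
    nlinarith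
  push_cast
  rcases (norm_nonneg D).eq_or_lt with h0 | h0
  · rw [← h0]; positivity
  · exact le_of_mul_le_mul_left h8 h0

end Smooth

/-! ### Conjugates of strongly convex functions -/

section Conjugate

variable {E : Type*} [NormedAddCommGroup E] [InnerProductSpace ℝ E]

theorem convexOn_of_isLUB_inner_sub {A : Set E} {g F : E → ℝ}
    (hF : ∀ x, IsLUB ((fun p => inner ℝ x p - g p) '' A) (F x)) : ConvexOn ℝ Set.univ F := by
  refine ⟨convex_univ, fun x _ y _ a b ha hb hab => (hF _).2 ?_⟩
  rintro _ ⟨p, hp, rfl⟩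
  have hx := mul_le_mul_of_nonneg_left ((hF x).1 ⟨p, hp, rfl⟩) ha
  have hy := mul_le_mul_of_nonneg_left ((hF y).1 ⟨p, hp, rfl⟩) hb
  have e : g p = a * g p + b * g p := by rw [← add_mul, hab, one_mul]
  simp only [inner_add_left, inner_smul_left, smul_eq_mul, RCLike.conj_to_real] at hx hy ⊢
  linarith

/-- The conjugate of a strongly convex function has a quadratic upper model at every point. -/
theorem _root_.StrongConvexOn.exists_quadratic_bound_conjugate [CompleteSpace E]
    {A : Set E} {g F : E → ℝ} {m : ℝ} (hm : 0 < m) (hg : StrongConvexOn A m g)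
    (hF : ∀ x, IsLUB ((fun p => inner ℝ x p - g p) '' A) (F x)) (x : E) :
    ∃ p : E, ∀ y, F y ≤ F x + inner ℝ p (y - x) + 1 / m * ‖y - x‖ ^ 2 := by
  -- Strong convexity at the midpoint, whose value is at most `F x`: near-maximizers are close
  -- together, so maximizing sequences are Cauchy.
  have key : ∀ p ∈ A, ∀ q ∈ A, m / 4 * ‖p - q‖ ^ 2 ≤
      (F x - (inner ℝ x p - g p)) + (F x - (inner ℝ x q - g q)) := by
    intro p hp q hq
    have h0 : (0 : ℝ) ≤ 1 / 2 := by norm_num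
    have h1 := hg.2 hp hq h0 h0 (add_halves 1)
    have h2 := (hF x).1 ⟨_, hg.1 hp hq h0 h0 (add_halves 1), rfl⟩
    simp only [inner_add_right, inner_smul_right, smul_eq_mul] at h1 h2
    linarith
  have hne : A.Nonempty := Set.image_nonempty.1 (hF x).nonempty
  have hseq : ∀ n : ℕ, ∃ p ∈ A, F x - 1 / (n + 1) < inner ℝ x p - g p := by
    intro n
    have h0 : (0 : ℝ) < 1 / (n + 1) := by positivity
    obtain ⟨_, ⟨p, hp, rfl⟩, h⟩ := (lt_isLUB_iff (hF x)).1 (sub_lt_self (F x) h0)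
    exact ⟨p, hp, h⟩
  choose u huA hu using hseq
  have hlim : Tendsto (fun n : ℕ => 1 / ((n : ℝ) + 1)) atTop (𝓝 0) :=
    tendsto_one_div_add_atTop_nhds_zero_nat
  have hcauchy : CauchySeq u := by
    refine cauchySeq_of_le_tendsto_0 (fun n : ℕ => √(8 / m * (1 / ((n : ℝ) + 1)))) ?_ ?_
    · intro i j n hi hj
      rw [dist_eq_norm]
      refine Real.le_sqrt_of_sq_le ?_
      have h1 := key _ (huA i) _ (huA j)
      have h2 : 1 / ((i : ℝ) + 1) ≤ 1 / ((n : ℝ) + 1) := by gcongr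
      have h3 : 1 / ((j : ℝ) + 1) ≤ 1 / ((n : ℝ) + 1) := by gcongr
      have h4 : m / 4 * ‖u i - u j‖ ^ 2 ≤ 2 * (1 / ((n : ℝ) + 1)) := by
        linarith [hu i, hu j]
      have h5 := mul_le_mul_of_nonneg_left h4 (by positivity : (0 : ℝ) ≤ 4 / m)
      have e1 : 4 / m * (m / 4 * ‖u i - u j‖ ^ 2) = ‖u i - u j‖ ^ 2 := by field_simp
      rw [e1] at h5
      refine h5.trans_eq ?_
      ring
    · have := (hlim.const_mul (8 / m)).sqrt
      simpa using this
  obtain ⟨p, hp⟩ := cauchySeq_tendsto_of_complete hcauchy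
  -- Only the norm passes to the limit, so p need not be known to lie in A.
  have hgrowth : ∀ q ∈ A, m / 4 * ‖q - p‖ ^ 2 ≤ F x - (inner ℝ x q - g q) := by
    intro q hq
    have h1 : Tendsto (fun n => m / 4 * ‖q - u n‖ ^ 2) atTop (𝓝 (m / 4 * ‖q - p‖ ^ 2)) :=
      ((tendsto_const_nhds.sub hp).norm.pow 2).const_mul _
    have h2 : Tendsto (fun n : ℕ => (F x - (inner ℝ x q - g q)) + 1 / ((n : ℝ) + 1)) atTop
        (𝓝 ((F x - (inner ℝ x q - g q)) + 0)) := tendsto_const_nhds.add hlim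
    rw [add_zero] at h2
    refine le_of_tendsto_of_tendsto' h1 h2 fun n => ?_
    linarith [key q hq _ (huA n), hu n]
  refine ⟨p, fun y => (hF y).2 ?_⟩
  rintro _ ⟨q, hq, rfl⟩
  have h1 := hgrowth q hq
  have h2 : inner ℝ (y - x) (q - p) ≤ ‖y - x‖ * ‖q - p‖ := real_inner_le_norm _ _
  have h3 : inner ℝ y q = inner ℝ x q + inner ℝ p (y - x) + inner ℝ (y - x) (q - p) := by
    rw [real_inner_comm (y - x) p]
    simp only [inner_sub_left, inner_sub_right]
    ring
  -- Young's inequality, weighted so that the growth term absorbs `‖q - p‖ ^ 2`.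
  have h4 : ‖y - x‖ * ‖q - p‖ ≤ 1 / m * ‖y - x‖ ^ 2 + m / 4 * ‖q - p‖ ^ 2 := by
    have h5 : 0 ≤ 1 / m * (‖y - x‖ - m / 2 * ‖q - p‖) ^ 2 := by positivity
    have e : 1 / m * (‖y - x‖ - m / 2 * ‖q - p‖) ^ 2 =
        1 / m * ‖y - x‖ ^ 2 + m / 4 * ‖q - p‖ ^ 2 - ‖y - x‖ * ‖q - p‖ := by
      field_simp; ring
    linarith
  simp only
  linarith

end Conjugate

/-! ### The convolutional loss: finiteness, convexity, smoothness -/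

section Loss

variable {N K d : ℕ}

/-- The real-valued Fenchel conjugate. -/
def realConj (Ω : Vec d → EReal) (θ : Vec d) : ℝ := (conj Ω θ).toReal

theorem IsAdmissible.coe_toReal {ρ : Fin K → Vec d} {Ω : Vec d → EReal} (h : IsAdmissible ρ Ω)
    {p : Vec d} (hp : p ∈ effDom Ω) : ((Ω p).toReal : EReal) = Ω p :=
  EReal.coe_toReal (ne_of_lt hp) (h.ne_bot p)

theorem IsAdmissible.coe_realConj {ρ : Fin K → Vec d} {Ω : Vec d → EReal}
    (h : IsAdmissible ρ Ω) (θ : Vec d) : (realConj Ω θ : EReal) = conj Ω θ := by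
  refine EReal.coe_toReal ?_ ?_
  · have : θ ∈ effDom (conj Ω) := h.dom_conj ▸ Set.mem_univ θ
    exact ne_of_lt this
  · obtain ⟨p, hp⟩ := h.dom_nonempty
    have h1 : ((inner ℝ θ p : ℝ) : EReal) - Ω p ≤ conj Ω θ :=
      le_iSup₂ (f := fun p (_ : p ∈ effDom Ω) => ((inner ℝ θ p : ℝ) : EReal) - Ω p) p hp
    rw [← h.coe_toReal hp, ← EReal.coe_sub] at h1
    exact ne_of_gt ((EReal.bot_lt_coe _).trans_le h1)

theorem IsAdmissible.isLUB_realConj {ρ : Fin K → Vec d} {Ω : Vec d → EReal}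
    (h : IsAdmissible ρ Ω) (θ : Vec d) :
    IsLUB ((fun p => inner ℝ θ p - (Ω p).toReal) '' effDom Ω) (realConj Ω θ) := by
  constructor
  · rintro _ ⟨p, hp, rfl⟩
    have h1 : ((inner ℝ θ p : ℝ) : EReal) - Ω p ≤ conj Ω θ :=
      le_iSup₂ (f := fun p (_ : p ∈ effDom Ω) => ((inner ℝ θ p : ℝ) : EReal) - Ω p) p hp
    rw [← h.coe_toReal hp, ← EReal.coe_sub, ← h.coe_realConj] at h1
    exact EReal.coe_le_coe_iff.1 h1
  · intro a ha
    rw [← EReal.coe_le_coe_iff, h.coe_realConj]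
    refine iSup₂_le fun p hp => ?_
    rw [← h.coe_toReal hp, ← EReal.coe_sub]
    exact EReal.coe_le_coe_iff.2 (ha ⟨p, hp, rfl⟩)

theorem lossMatrixMul_combo (ℓρ : Fin N → Vec d) (a b : ℝ) (π π' : Fin N → ℝ) :
    lossMatrixMul ℓρ (a • π + b • π') = a • lossMatrixMul ℓρ π + b • lossMatrixMul ℓρ π' := by
  simp [lossMatrixMul, add_smul, Finset.sum_add_distrib, Finset.smul_sum, mul_smul]

theorem lossMatrixMul_single (ℓρ : Fin N → Vec d) (t : Fin N) :
    lossMatrixMul ℓρ (Pi.single t 1) = ℓρ t := by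
  simp [lossMatrixMul, Pi.single_apply, ite_smul]

theorem continuous_lossMatrixMul (ℓρ : Fin N → Vec d) : Continuous (lossMatrixMul ℓρ) := by
  unfold lossMatrixMul
  fun_prop

theorem mem_minimizers_iff {ρ : Fin K → Vec d} {Ω : Vec d → EReal} (h : IsAdmissible ρ Ω)
    {ℓρ : Fin N → Vec d} {θ : Vec d} {π : Fin N → ℝ} :
    π ∈ minimizers Ω ℓρ θ ↔ π ∈ stdSimplex ℝ (Fin N) ∧ ∀ π' ∈ stdSimplex ℝ (Fin N),
      realConj Ω (θ + lossMatrixMul ℓρ π) ≤ realConj Ω (θ + lossMatrixMul ℓρ π') := by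
  simp only [minimizers, Set.mem_ofPred_eq, ← h.coe_realConj, EReal.coe_le_coe_iff]

/-- A finite convex function on ℝ^d is continuous, and the simplex is compact. -/
theorem minimizers_nonempty (hN : 0 < N) {ρ : Fin K → Vec d} {Ω : Vec d → EReal}
    (h : IsAdmissible ρ Ω) (ℓρ : Fin N → Vec d) (θ : Vec d) : (minimizers Ω ℓρ θ).Nonempty := by
  have hcont : Continuous (realConj Ω) :=
    (convexOn_of_isLUB_inner_sub h.isLUB_realConj).locallyLipschitz.continuous
  obtain ⟨π, hπ, hmin⟩ := (isCompact_stdSimplex ℝ (Fin N)).exists_isMinOn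
    ⟨_, single_mem_stdSimplex ℝ (⟨0, hN⟩ : Fin N)⟩
    (f := fun π => realConj Ω (θ + lossMatrixMul ℓρ π))
    (hcont.comp (continuous_const.add (continuous_lossMatrixMul ℓρ))).continuousOn
  exact ⟨π, (mem_minimizers_iff h).2 ⟨hπ, fun π' hπ' => hmin hπ'⟩⟩

/-- The value function `θ ↦ min_π Ω^*(θ + ℒ^ρ π)`. -/
def convConj (Ω : Vec d → EReal) (ℓρ : Fin N → Vec d) (θ : Vec d) : ℝ :=
  ⨅ π : stdSimplex ℝ (Fin N), realConj Ω (θ + lossMatrixMul ℓρ π)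

theorem convConj_eq {ρ : Fin K → Vec d} {Ω : Vec d → EReal} (h : IsAdmissible ρ Ω)
    {ℓρ : Fin N → Vec d} {θ : Vec d} {π : Fin N → ℝ} (hπ : π ∈ minimizers Ω ℓρ θ) :
    convConj Ω ℓρ θ = realConj Ω (θ + lossMatrixMul ℓρ π) := by
  rw [mem_minimizers_iff h] at hπ
  have : IsLeast (Set.range fun π : stdSimplex ℝ (Fin N) =>
      realConj Ω (θ + lossMatrixMul ℓρ π)) (realConj Ω (θ + lossMatrixMul ℓρ π)) :=
    ⟨⟨⟨π, hπ.1⟩, rfl⟩, by rintro _ ⟨π', rfl⟩; exact hπ.2 _ π'.2⟩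
  exact this.csInf_eq

theorem convConj_le (hN : 0 < N) {ρ : Fin K → Vec d} {Ω : Vec d → EReal} (h : IsAdmissible ρ Ω)
    {ℓρ : Fin N → Vec d} (θ : Vec d) {π : Fin N → ℝ} (hπ : π ∈ stdSimplex ℝ (Fin N)) :
    convConj Ω ℓρ θ ≤ realConj Ω (θ + lossMatrixMul ℓρ π) := by
  obtain ⟨π₀, h₀⟩ := minimizers_nonempty hN h ℓρ θ
  rw [convConj_eq h h₀]
  exact ((mem_minimizers_iff h).1 h₀).2 _ hπ

theorem coe_convConj (hN : 0 < N) {ρ : Fin K → Vec d} {Ω : Vec d → EReal} (h : IsAdmissible ρ Ω)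
    (ℓρ : Fin N → Vec d) (θ : Vec d) :
    (convConj Ω ℓρ θ : EReal) =
      ⨅ π ∈ stdSimplex ℝ (Fin N), conj Ω (θ + lossMatrixMul ℓρ π) := by
  obtain ⟨π₀, h₀⟩ := minimizers_nonempty hN h ℓρ θ
  rw [convConj_eq h h₀, h.coe_realConj]
  exact le_antisymm (le_iInf₂ h₀.2) (iInf₂_le π₀ h₀.1)

theorem convexOn_convConj (hN : 0 < N) {ρ : Fin K → Vec d} {Ω : Vec d → EReal}
    (h : IsAdmissible ρ Ω) (ℓρ : Fin N → Vec d) : ConvexOn ℝ Set.univ (convConj Ω ℓρ) := by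
  refine ⟨convex_univ, fun x _ y _ a b ha hb hab => ?_⟩
  obtain ⟨π, hπ⟩ := minimizers_nonempty hN h ℓρ x
  obtain ⟨π', hπ'⟩ := minimizers_nonempty hN h ℓρ y
  rw [convConj_eq h hπ, convConj_eq h hπ']
  refine (convConj_le hN h _ (convex_stdSimplex ℝ (Fin N) hπ.1 hπ'.1 ha hb hab)).trans ?_
  have e : a • x + b • y + lossMatrixMul ℓρ (a • π + b • π') =
      a • (x + lossMatrixMul ℓρ π) + b • (y + lossMatrixMul ℓρ π') := by
    rw [lossMatrixMul_combo]; module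
  rw [e]
  exact (convexOn_of_isLUB_inner_sub h.isLUB_realConj).2 (Set.mem_univ _) (Set.mem_univ _)
    ha hb hab

/-- The minimizer at x stays feasible at y, so the model of Ω^* at the shifted point serves. -/
theorem exists_quadratic_bound_convConj (hN : 0 < N) {ρ : Fin K → Vec d} {Ω : Vec d → EReal}
    (h : IsAdmissible ρ Ω) {m : ℝ} (hm : 0 < m)
    (hsc : StrongConvexOn (effDom Ω) m fun p => (Ω p).toReal) (ℓρ : Fin N → Vec d) (x : Vec d) :
    ∃ p : Vec d, ∀ y, convConj Ω ℓρ y ≤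
      convConj Ω ℓρ x + inner ℝ p (y - x) + 1 / m * ‖y - x‖ ^ 2 := by
  obtain ⟨π, hπ⟩ := minimizers_nonempty hN h ℓρ x
  obtain ⟨p, hp⟩ := hsc.exists_quadratic_bound_conjugate hm h.isLUB_realConj
    (x + lossMatrixMul ℓρ π)
  refine ⟨p, fun y => (convConj_le hN h y hπ.1).trans ?_⟩
  rw [convConj_eq h hπ]
  simpa only [add_sub_add_right_eq_sub] using hp (y + lossMatrixMul ℓρ π)

/-- The real value of the convolutional Fenchel–Young loss. -/
def realLoss (Ω : Vec d → EReal) (ρ : Fin K → Vec d) (ℓρ : Fin N → Vec d) (θ : Vec d)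
    (y : Fin K) : ℝ :=
  convConj Ω ℓρ θ + ((Ω (ρ y)).toReal + polyT ℓρ (ρ y)) - inner ℝ θ (ρ y)

theorem convFYLoss_eq_coe (hN : 0 < N) {ρ : Fin K → Vec d} {Ω : Vec d → EReal}
    (h : IsAdmissible ρ Ω) (ℓρ : Fin N → Vec d) (θ : Vec d) (y : Fin K) :
    convFYLoss Ω ρ ℓρ θ y = (realLoss Ω ρ ℓρ θ y : EReal) := by
  have hy : ρ y ∈ effDom Ω := h.hull_subset (subset_convexHull ℝ _ ⟨y, rfl⟩)
  rw [convFYLoss, convNegentropy, ← coe_convConj hN h, ← h.coe_toReal hy, realLoss,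
    EReal.coe_sub, EReal.coe_add, EReal.coe_add]

theorem convexOn_realLoss (hN : 0 < N) {ρ : Fin K → Vec d} {Ω : Vec d → EReal}
    (h : IsAdmissible ρ Ω) (ℓρ : Fin N → Vec d) (y : Fin K) :
    ConvexOn ℝ Set.univ fun θ => realLoss Ω ρ ℓρ θ y := by
  refine ⟨convex_univ, fun x _ x' _ a b ha hb hab => ?_⟩
  have h1 := (convexOn_convConj hN h ℓρ).2 (Set.mem_univ x) (Set.mem_univ x') ha hb hab
  simp only [realLoss, inner_add_left, inner_smul_left, smul_eq_mul, RCLike.conj_to_real] at h1 ⊢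
  obtain rfl : b = 1 - a := by linarith
  linarith

theorem smooth_realLoss (hN : 0 < N) {ρ : Fin K → Vec d} {Ω : Vec d → EReal}
    (h : IsAdmissible ρ Ω) (hsc : IsStronglyConvexOnDom Ω) (ℓρ : Fin N → Vec d) (y : Fin K) :
    Differentiable ℝ (fun θ => realLoss Ω ρ ℓρ θ y) ∧
      ∃ β : NNReal, LipschitzWith β (gradient fun θ => realLoss Ω ρ ℓρ θ y) := by
  obtain ⟨m, hm, hsc⟩ := hsc
  choose p hp using exists_quadratic_bound_convConj hN h hm hsc ℓρ
  obtain ⟨C, hC⟩ : ∃ C : NNReal, (C : ℝ) = 1 / m := ⟨⟨1 / m, by positivity⟩, rfl⟩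
  have hC0 : 0 < C := by rw [← NNReal.coe_pos, hC]; positivity
  have hq : ∀ x x', realLoss Ω ρ ℓρ x' y ≤ realLoss Ω ρ ℓρ x y + inner ℝ (p x - ρ y) (x' - x) +
      C * ‖x' - x‖ ^ 2 := by
    intro x x'
    have h1 := hp x x'
    have h2 : inner ℝ (ρ y) (x' - x) = inner ℝ x' (ρ y) - inner ℝ x (ρ y) := by
      rw [real_inner_comm, inner_sub_left]
    rw [inner_sub_left, h2, hC]
    unfold realLoss
    linarith
  have hconv := convexOn_realLoss hN h ℓρ y
  have hgrad : ∀ x, HasGradientAt (fun θ => realLoss Ω ρ ℓρ θ y) (p x - ρ y) x :=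
    fun x => hconv.hasGradientAt_of_quadratic_bound (hq x)
  refine ⟨fun x => (hgrad x).differentiableAt, 4 * C, ?_⟩
  rw [show gradient (fun θ => realLoss Ω ρ ℓρ θ y) = fun x => p x - ρ y from
    funext fun x => (hgrad x).gradient]
  exact hconv.lipschitzWith_of_quadratic_bound hC0 hq

/-! ### Argmax links and the regret bound -/

theorem exists_isArgmaxLink (hN : 0 < N) {ρ : Fin K → Vec d} {Ω : Vec d → EReal}
    (h : IsAdmissible ρ Ω) (ℓρ : Fin N → Vec d) :
    ∃ φ : Vec d → Fin N, IsArgmaxLink Ω ℓρ φ := by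
  have : Nonempty (Fin N) := ⟨⟨0, hN⟩⟩
  choose π hπ using minimizers_nonempty hN h ℓρ
  choose φ hφ using fun θ => Finite.exists_max (π θ)
  exact ⟨φ, π, hπ, hφ⟩

theorem surrogateRisk_eq_coe (hN : 0 < N) {ρ : Fin K → Vec d} {Ω : Vec d → EReal}
    (h : IsAdmissible ρ Ω) (ℓρ : Fin N → Vec d) (θ : Vec d) (η : Fin K → ℝ) :
    surrogateRisk (convFYLoss Ω ρ ℓρ) θ η = ((∑ y, η y * realLoss Ω ρ ℓρ θ y : ℝ) : EReal) := by
  simp only [surrogateRisk, convFYLoss_eq_coe hN h, ← EReal.coe_mul]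
  exact (map_sum (⟨⟨Real.toEReal, EReal.coe_zero⟩, EReal.coe_add⟩ : ℝ →+ EReal) _ _).symm

theorem sum_mul_realLoss_sub {ρ : Fin K → Vec d} (Ω : Vec d → EReal) (ℓρ : Fin N → Vec d)
    (θ θ' : Vec d) {η : Fin K → ℝ} (hη : η ∈ stdSimplex ℝ (Fin K)) :
    ∑ y, η y * realLoss Ω ρ ℓρ θ y - ∑ y, η y * realLoss Ω ρ ℓρ θ' y =
      convConj Ω ℓρ θ - convConj Ω ℓρ θ' + inner ℝ (θ' - θ) (∑ y, η y • ρ y) := by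
  have h1 : convConj Ω ℓρ θ - convConj Ω ℓρ θ' =
      ∑ y, η y * (convConj Ω ℓρ θ - convConj Ω ℓρ θ') := by
    rw [← Finset.sum_mul, hη.2, one_mul]
  rw [h1, inner_sum, ← Finset.sum_sub_distrib, ← Finset.sum_add_distrib]
  refine Finset.sum_congr rfl fun y _ => ?_
  rw [inner_smul_right, inner_sub_left, realLoss, realLoss]
  ring

theorem targetRisk_eq {ℓ : Fin N → Fin K → ℝ} {ρ : Fin K → Vec d} {ℓρ : Fin N → Vec d}
    {c : Fin K → ℝ} (hdec : IsDecomposition ℓ ρ ℓρ c) (t : Fin N) (η : Fin K → ℝ) :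
    targetRisk ℓ t η = inner ℝ (ℓρ t) (∑ y, η y • ρ y) + ∑ y, η y * c y := by
  rw [targetRisk, inner_sum, ← Finset.sum_add_distrib]
  refine Finset.sum_congr rfl fun y _ => ?_
  rw [hdec, inner_smul_right, real_inner_comm]
  ring

/-- The regret of a most likely prediction is at most `N` times the average regret. -/
theorem targetRisk_sub_le_of_isArgmax {r : Fin N → ℝ} {π : Fin N → ℝ}
    (hπ : π ∈ stdSimplex ℝ (Fin N)) {s t : Fin N} (hs : ∀ i, π i ≤ π s) (ht : ∀ i, r t ≤ r i) :
    r s - r t ≤ N * ∑ i, π i * (r i - r t) := by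
  have h1 : 1 ≤ N * π s := by
    calc (1 : ℝ) = ∑ i, π i := hπ.2.symm
      _ ≤ ∑ _i : Fin N, π s := Finset.sum_le_sum fun i _ => hs i
      _ = N * π s := by simp
  have h2 : π s * (r s - r t) ≤ ∑ i, π i * (r i - r t) :=
    Finset.single_le_sum (f := fun i => π i * (r i - r t))
      (fun i _ => mul_nonneg (hπ.1 i) (sub_nonneg.2 (ht i))) (Finset.mem_univ s)
  calc r s - r t ≤ N * π s * (r s - r t) := le_mul_of_one_le_left (sub_nonneg.2 (ht s)) h1
    _ = N * (π s * (r s - r t)) := mul_assoc _ _ _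
    _ ≤ _ := mul_le_mul_of_nonneg_left h2 (Nat.cast_nonneg N)

theorem targetRegret_le (hN : 0 < N) {ℓ : Fin N → Fin K → ℝ} {ρ : Fin K → Vec d}
    {ℓρ : Fin N → Vec d} {c : Fin K → ℝ} (hdec : IsDecomposition ℓ ρ ℓρ c) {Ω : Vec d → EReal}
    (h : IsAdmissible ρ Ω) {φ : Vec d → Fin N} (hφ : IsArgmaxLink Ω ℓρ φ) (θ : Vec d)
    {η : Fin K → ℝ} (hη : η ∈ stdSimplex ℝ (Fin K)) :
    ((targetRegret ℓ (φ θ) η : ℝ) : EReal) ≤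
      (N : EReal) * surrogateRegret (convFYLoss Ω ρ ℓρ) θ η := by
  have : Nonempty (Fin N) := ⟨⟨0, hN⟩⟩
  obtain ⟨π, hπ, hmax⟩ := hφ
  obtain ⟨t, ht⟩ := Finite.exists_min fun t => targetRisk ℓ t η
  have hbayes : targetBayesRisk ℓ η = targetRisk ℓ t η :=
    IsLeast.csInf_eq ⟨⟨t, rfl⟩, by rintro _ ⟨i, rfl⟩; exact ht i⟩
  set p : Vec d := ∑ y, η y • ρ y with hp
  -- Chosen so that the vertex t at θ' gives the same argument of Ω^* as π(θ) at θ.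
  set θ' : Vec d := θ + lossMatrixMul ℓρ (π θ) - ℓρ t with hθ'
  set r : ℝ := ∑ y, η y * realLoss Ω ρ ℓρ θ y - ∑ y, η y * realLoss Ω ρ ℓρ θ' y with hr
  have hle : convConj Ω ℓρ θ' ≤ convConj Ω ℓρ θ := by
    refine (convConj_le hN h θ' (single_mem_stdSimplex ℝ t)).trans_eq ?_
    rw [lossMatrixMul_single, convConj_eq h (hπ θ), hθ', sub_add_cancel]
  have hsum : ∑ i, π θ i * (targetRisk ℓ i η - targetRisk ℓ t η) = inner ℝ (θ' - θ) p := by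
    have e : θ' - θ = ∑ i, π θ i • (ℓρ i - ℓρ t) := by
      simp only [smul_sub, Finset.sum_sub_distrib]
      rw [← Finset.sum_smul, (hπ θ).1.2, one_smul, hθ', lossMatrixMul]
      abel
    rw [e, sum_inner]
    refine Finset.sum_congr rfl fun i _ => ?_
    rw [targetRisk_eq hdec, targetRisk_eq hdec, inner_smul_left, inner_sub_left,
      RCLike.conj_to_real, add_sub_add_right_eq_sub]
  have hreal : targetRegret ℓ (φ θ) η ≤ N * r := by
    rw [targetRegret, hbayes]
    refine (targetRisk_sub_le_of_isArgmax (r := fun i => targetRisk ℓ i η) (hπ θ).1 (hmax θ) ht).trans ?_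
    refine mul_le_mul_of_nonneg_left ?_ (Nat.cast_nonneg N)
    rw [hsum, hr, sum_mul_realLoss_sub Ω ℓρ θ θ' hη]
    linarith
  have hregret : (r : EReal) ≤ surrogateRegret (convFYLoss Ω ρ ℓρ) θ η := by
    rw [surrogateRegret, surrogateRisk_eq_coe hN h, hr, EReal.coe_sub,
      ← surrogateRisk_eq_coe hN h ℓρ θ']
    -- One competitor suffices; the infimum need not be attained.
    exact EReal.sub_le_sub le_rfl (iInf_le _ θ')
  calc ((targetRegret ℓ (φ θ) η : ℝ) : EReal) ≤ ((N * r : ℝ) : EReal) :=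
        EReal.coe_le_coe_iff.2 hreal
    _ = (N : EReal) * (r : EReal) := by rw [EReal.coe_mul]; rfl
    _ ≤ _ := mul_le_mul_of_nonneg_left hregret (by positivity)

end Loss

end ConvFY

end

theorem theorem2 {N K d : ℕ} (hN : 0 < N)
    (ℓ : Fin N → Fin K → ℝ) (ρ : Fin K → ConvFY.Vec d) (ℓρ : Fin N → ConvFY.Vec d)
    (c : Fin K → ℝ) (hdec : ConvFY.IsDecomposition ℓ ρ ℓρ c)
    (Ω : ConvFY.Vec d → EReal) (hΩ : ConvFY.IsAdmissible ρ Ω)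
    (hsc : ConvFY.IsStronglyConvexOnDom Ω) :
    (∀ y : Fin K, ∃ f : ConvFY.Vec d → ℝ,
      (∀ θ, ConvFY.convFYLoss Ω ρ ℓρ θ y = (f θ : EReal)) ∧
      ConvexOn ℝ Set.univ f ∧
      Differentiable ℝ f ∧
      ∃ β : NNReal, LipschitzWith β (gradient f)) ∧
    (∃ φ : ConvFY.Vec d → Fin N, ConvFY.IsArgmaxLink Ω ℓρ φ) ∧
    (∀ φ : ConvFY.Vec d → Fin N, ConvFY.IsArgmaxLink Ω ℓρ φ →
      ∀ (θ : ConvFY.Vec d) (η : Fin K → ℝ), η ∈ stdSimplex ℝ (Fin K) →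
        ((ConvFY.targetRegret ℓ (φ θ) η : ℝ) : EReal) ≤
          (N : EReal) * ConvFY.surrogateRegret (ConvFY.convFYLoss Ω ρ ℓρ) θ η) := by
  refine ⟨fun y => ?_, ConvFY.exists_isArgmaxLink hN hΩ ℓρ, fun φ hφ θ η hη =>
    ConvFY.targetRegret_le hN hdec hΩ hφ θ hη⟩
  obtain ⟨hdiff, hlip⟩ := ConvFY.smooth_realLoss hN hΩ hsc ℓρ y
  exact ⟨fun θ => ConvFY.realLoss Ω ρ ℓρ θ y, fun θ => ConvFY.convFYLoss_eq_coe hN hΩ ℓρ θ y,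
    ConvFY.convexOn_realLoss hN hΩ ℓρ y, hdiff, hlip⟩
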